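/- Let $N$ be a positive integer, let $\varepsilon\in\mathbb{R}$, and let $p_i,\ \xi_{i0},\ C_i\in\mathbb{C}$ ($1\le i\le N$) be parameters such that $$p_i^*=p_{N+1-i},\qquad \xi_{i0}^*=\xi_{N+1-i,0}\qquad(1\le i\le N),$$ where $*$ denotes complex conjugation, and such that $p_i+p_j^*\neq 0$ for all $i,j$. For real $x,t$ put $\xi_i=p_ix+p_i^3t+\xi_{i0}$, let $M=(m_{ij})$ be the $N\times N$ matrix with entries $$m_{ij}=\frac{1}{p_i+p_j^*}\Bigl(e^{\xi_i+\xi_j^*}-\varepsilon C_i^*C_j-\varepsilon C_{N+1-i}C_{N+1-j}^*\Bigr),$$ and let $$f=\det M,\qquad g=\begin{vmatrix}M&\Phi\\-\bar\Psi^{T}&0\end{vmatrix},\qquad \Phi=(e^{\xi_1},\dots,e^{\xi_N})^T,\quad \bar\Psi=(C_1,\dots,C_N)^T.$$ Then $u=g/f$ (the $N$-bright soliton solution) is a solution of the Sasa–Satsuma equation $$u_t=u_{xxx}-6\varepsilon|u|^2u_x-3\varepsilon u\,(|u|^2)_x$$ wherever it is defined: the set $\{(x,t)\in\mathbb{R}^2: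 f(x,t)\neq 0\}$ is open, and on it $u$ is $C^\infty$ and satisfies the equation. -/

import Mathlib

open scoped ContDiff ComplexConjugate

noncomputable section

namespace SasaSatsuma

/-- `u : ℝ → ℝ → ℂ`, written `u x t`, is a (smooth, classical) solution on the open set `Ω` of the
`(x, t)`-plane of the Sasa-Satsuma equation
`u_t = u_xxx - 6 ε |u|² u_x - 3 ε u (|u|²)_x`. -/
def IsSolutionOn (ε : ℝ) (u : ℝ → ℝ → ℂ) (Ω : Set (ℝ × ℝ)) : Prop :=
  IsOpen Ω ∧
  ContDiffOn ℝ ∞ (fun z : ℝ × ℝ => u z.1 z.2) Ω ∧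
  ∀ x t : ℝ, (x, t) ∈ Ω →
    deriv (fun s => u x s) t =
      iteratedDeriv 3 (fun y => u y t) x
        - 6 * (ε : ℂ) * ((‖u x t‖ ^ 2 : ℝ) : ℂ) * deriv (fun y => u y t) x
        - 3 * (ε : ℂ) * u x t * ((deriv (fun y => ‖u y t‖ ^ 2) x : ℝ) : ℂ)

variable {N : ℕ}

/-- The phase `ξ_i = p_i x + p_i³ t + ξ_{i0}`. -/
def phase (p ξ₀ : Fin N → ℂ) (x t : ℝ) (i : Fin N) : ℂ :=
  p i * x + p i ^ 3 * t + ξ₀ i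

/-- The matrix `M` with entries
`m_ij = (e^{ξ_i + ξ_j^*} - ε C_i^* C_j - ε C_{N+1-i} C_{N+1-j}^*) / (p_i + p_j^*)`.
The index reflection `i ↦ N + 1 - i` of `{1, …, N}` is `Fin.rev` on `Fin N`. -/
def mat (ε : ℝ) (p ξ₀ C : Fin N → ℂ) (x t : ℝ) : Matrix (Fin N) (Fin N) ℂ :=
  Matrix.of fun i j =>
    1 / (p i + conj (p j)) *
      (Complex.exp (phase p ξ₀ x t i + conj (phase p ξ₀ x t j))
        - ε * conj (C i) * C j
        - ε * C i.rev * conj (C j.rev))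

/-- `f = |M|`. -/
def tauF (ε : ℝ) (p ξ₀ C : Fin N → ℂ) (x t : ℝ) : ℂ :=
  (mat ε p ξ₀ C x t).det

/-- The bordered determinant `g`, of the block matrix with rows `(M, Φ)` and `(-Ψᵀ, 0)`, where
`Φ` is the column `(e^{ξ_1}, …, e^{ξ_N})ᵀ` and `Ψᵀ` is the row `(C_1, …, C_N)`. -/
def tauG (ε : ℝ) (p ξ₀ C : Fin N → ℂ) (x t : ℝ) : ℂ :=
  (Matrix.fromBlocks (mat ε p ξ₀ C x t)
    (Matrix.replicateCol Unit fun i => Complex.exp (phase p ξ₀ x t i))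
    (-Matrix.replicateRow Unit C)
    (0 : Matrix Unit Unit ℂ)).det

/-- `u = g / f`; meaningful where `f ≠ 0`. -/
def brightSoliton (ε : ℝ) (p ξ₀ C : Fin N → ℂ) (x t : ℝ) : ℂ :=
  tauG ε p ξ₀ C x t / tauF ε p ξ₀ C x t

end SasaSatsuma

end

/-! Reversing the columns of M gives a symmetric matrix K. Write φ for the vector of e^{ξ_i}, A =
diag(p), c = C^* and d for C reversed. Then u = dᵀK⁻¹φ and u^* = cᵀK⁻¹φ, so u and u^* are two
entries of one family of scalars U_k = dᵀK⁻¹Aᵏφ, V_k = cᵀK⁻¹Aᵏφ, S_jk = (Aʲφ)ᵀK⁻¹Aᵏφ. The family is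
closed under differentiation: K_x = φφᵀ and K_t is a sum of three rank-one matrices, while the
Sylvester equation AK + KA = φφᵀ - ε(cdᵀ + dcᵀ) gives S_jk' = -ε(V_j U_k + U_j V_k). The PDE thus
becomes a polynomial identity in U, V, S; modulo the symmetry of S, it is u_x times 2 S_01 = S_00² -
2ε|u|². -/

namespace SasaSatsuma

open Matrix

/-! ### Calculus of αᵀK⁻¹β -/

section InverseDeriv

variable {n : Type*} [Fintype n] [DecidableEq n]

/-- The entrywise derivative of the inverse of a matrix-valued function. -/
theorem hasDerivAt_matrix_inv {K : ℝ → Matrix n n ℂ} {K' : Matrix n n ℂ} {x : ℝ}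
    (hK : ∀ i j, HasDerivAt (fun y => K y i j) (K' i j) x) (hdet : (K x).det ≠ 0) (i j : n) :
    HasDerivAt (fun y => (K y)⁻¹ i j) (-((K x)⁻¹ * K' * (K x)⁻¹) i j) x := by
  let _ : NormedRing (Matrix n n ℂ) := Matrix.linftyOpNormedRing
  let _ : NormedAlgebra ℝ (Matrix n n ℂ) := Matrix.linftyOpNormedAlgebra
  have hK₀ : HasDerivAt K K' x :=
    hasDerivAt_pi.2 fun i => hasDerivAt_pi.2 fun j => hK i j
  have hu : IsUnit (K x) := (Matrix.isUnit_iff_isUnit_det _).2 hdet.isUnit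
  obtain ⟨w, hw⟩ := hu
  have h₁ := hasFDerivAt_ringInverse (𝕜 := ℝ) w
  rw [hw] at h₁
  have h₂ := h₁.comp_hasDerivAt x hK₀
  have hw' : (↑w⁻¹ : Matrix n n ℂ) = (K x)⁻¹ := by rw [← hw, Matrix.coe_units_inv]
  have h₃ := hasDerivAt_pi.1 (hasDerivAt_pi.1 h₂ i) j
  have h₄ : ∀ y, (K y)⁻¹ i j = (Ring.inverse ∘ K) y i j := fun y => by
    rw [Matrix.nonsing_inv_eq_ringInverse, Function.comp_apply]
  simp only [h₄]
  refine h₃.congr_deriv ?_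
  rw [← hw']
  rfl

omit [DecidableEq n] in
theorem hasDerivAt_dotProduct {α β : ℝ → n → ℂ} {α' β' : n → ℂ} {x : ℝ}
    (hα : ∀ i, HasDerivAt (fun y => α y i) (α' i) x)
    (hβ : ∀ i, HasDerivAt (fun y => β y i) (β' i) x) :
    HasDerivAt (fun y => α y ⬝ᵥ β y) (α' ⬝ᵥ β x + α x ⬝ᵥ β') x := by
  simp only [dotProduct, ← Finset.sum_add_distrib]
  exact HasDerivAt.fun_sum fun i _ => (hα i).fun_mul (hβ i)

/-- The derivative of the bilinear pairing `αᵀ K⁻¹ β`. -/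
theorem hasDerivAt_dotProduct_inv_mulVec {K : ℝ → Matrix n n ℂ} {K' : Matrix n n ℂ}
    {α β : ℝ → n → ℂ} {α' β' : n → ℂ} {x : ℝ}
    (hK : ∀ i j, HasDerivAt (fun y => K y i j) (K' i j) x) (hdet : (K x).det ≠ 0)
    (hα : ∀ i, HasDerivAt (fun y => α y i) (α' i) x)
    (hβ : ∀ i, HasDerivAt (fun y => β y i) (β' i) x) :
    HasDerivAt (fun y => α y ⬝ᵥ (K y)⁻¹ *ᵥ β y)
      (α' ⬝ᵥ (K x)⁻¹ *ᵥ β x + α x ⬝ᵥ (K x)⁻¹ *ᵥ β'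
        - α x ⬝ᵥ ((K x)⁻¹ * K' * (K x)⁻¹) *ᵥ β x) x := by
  have h := hasDerivAt_dotProduct hα
    (fun i => hasDerivAt_dotProduct (fun j => hasDerivAt_matrix_inv hK hdet i j) hβ)
  refine h.congr_deriv ?_
  have : (fun i => (fun j => -((K x)⁻¹ * K' * (K x)⁻¹) i j) ⬝ᵥ β x + (fun j => (K x)⁻¹ i j) ⬝ᵥ β')
      = -(((K x)⁻¹ * K' * (K x)⁻¹) *ᵥ β x) + (K x)⁻¹ *ᵥ β' := by
    rw [← neg_mulVec]; rfl
  rw [this, dotProduct_add, dotProduct_neg]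
  change _ + (-_ + _) = _
  have : (fun i => (fun j => (K x)⁻¹ i j) ⬝ᵥ β x) = (K x)⁻¹ *ᵥ β x := rfl
  rw [this]; ring

omit [DecidableEq n] in
-- Turns rank-one derivatives of K into products of scalar pairings.
theorem dotProduct_mul_vecMulVec_mul_mulVec (G : Matrix n n ℂ) (α β c d : n → ℂ) :
    α ⬝ᵥ (G * vecMulVec c d * G) *ᵥ β = (α ⬝ᵥ G *ᵥ c) * (d ⬝ᵥ G *ᵥ β) := by
  rw [← mulVec_mulVec, ← mulVec_mulVec, vecMulVec_mulVec]
  simp [mulVec_smul, mul_comm]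

omit [DecidableEq n] in
theorem dotProduct_mulVec_comm_of_transpose_eq {G : Matrix n n ℂ} (hG : Gᵀ = G) (α β : n → ℂ) :
    α ⬝ᵥ G *ᵥ β = β ⬝ᵥ G *ᵥ α := by
  rw [dotProduct_mulVec, ← mulVec_transpose, hG, dotProduct_comm]

end InverseDeriv

/-! ### The symmetric Gram matrix and its derivatives -/

variable {N : ℕ}

/-- The vector `Aᵏ φ` with entries `p_iᵏ e^{ξ_i}`. -/
noncomputable def wave (p ξ₀ : Fin N → ℂ) (k : ℕ) (x t : ℝ) (i : Fin N) : ℂ :=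
  p i ^ k * Complex.exp (phase p ξ₀ x t i)

/-- The symmetric form of `mat`, obtained by reversing the columns. -/
noncomputable def symMat (ε : ℝ) (p ξ₀ C : Fin N → ℂ) (x t : ℝ) : Matrix (Fin N) (Fin N) ℂ :=
  (mat ε p ξ₀ C x t).submatrix id Fin.revPerm

/-- The pairing `cᵀ K⁻¹ Aᵏ φ` with a constant vector `c`. -/
noncomputable def pairing (ε : ℝ) (p ξ₀ C c : Fin N → ℂ) (k : ℕ) (x t : ℝ) : ℂ :=
  c ⬝ᵥ (symMat ε p ξ₀ C x t)⁻¹ *ᵥ wave p ξ₀ k x t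

/-- The potential `(Aʲ φ)ᵀ K⁻¹ Aᵏ φ`. -/
noncomputable def potential (ε : ℝ) (p ξ₀ C : Fin N → ℂ) (j k : ℕ) (x t : ℝ) : ℂ :=
  wave p ξ₀ j x t ⬝ᵥ (symMat ε p ξ₀ C x t)⁻¹ *ᵥ wave p ξ₀ k x t

theorem hasDerivAt_wave_fst (p ξ₀ : Fin N → ℂ) (k : ℕ) (x t : ℝ) (i : Fin N) :
    HasDerivAt (fun y => wave p ξ₀ k y t i) (wave p ξ₀ (k + 1) x t i) x := by
  have h : HasDerivAt (fun y : ℝ => phase p ξ₀ y t i) (p i) x := by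
    simpa [phase] using
      (((hasDerivAt_id x).ofReal_comp.const_mul (p i)).add_const (p i ^ 3 * t)).add_const (ξ₀ i)
  exact (h.cexp.const_mul (p i ^ k)).congr_deriv (by simp only [wave]; ring)

theorem hasDerivAt_wave_snd (p ξ₀ : Fin N → ℂ) (k : ℕ) (x t : ℝ) (i : Fin N) :
    HasDerivAt (fun s => wave p ξ₀ k x s i) (wave p ξ₀ (k + 3) x t i) t := by
  have h : HasDerivAt (fun s : ℝ => phase p ξ₀ x s i) (p i ^ 3) t := by
    simpa [phase] using
      (((hasDerivAt_id t).ofReal_comp.const_mul (p i ^ 3)).const_add (p i * x)).add_const (ξ₀ i)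
  exact (h.cexp.const_mul (p i ^ k)).congr_deriv (by simp only [wave]; ring)

theorem conj_phase {p ξ₀ : Fin N → ℂ} (hp : ∀ i, conj (p i) = p i.rev)
    (hξ : ∀ i, conj (ξ₀ i) = ξ₀ i.rev) (x t : ℝ) (i : Fin N) :
    conj (phase p ξ₀ x t i) = phase p ξ₀ x t i.rev := by
  simp [phase, hp, hξ]

theorem conj_wave_zero {p ξ₀ : Fin N → ℂ} (hp : ∀ i, conj (p i) = p i.rev)
    (hξ : ∀ i, conj (ξ₀ i) = ξ₀ i.rev) (x t : ℝ) (i : Fin N) :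
    conj (wave p ξ₀ 0 x t i) = wave p ξ₀ 0 x t i.rev := by
  simp [wave, ← Complex.exp_conj, conj_phase hp hξ]

theorem symMat_apply {ε : ℝ} {p ξ₀ C : Fin N → ℂ} (hp : ∀ i, conj (p i) = p i.rev)
    (hξ : ∀ i, conj (ξ₀ i) = ξ₀ i.rev) (x t : ℝ) (i j : Fin N) :
    symMat ε p ξ₀ C x t i j =
      1 / (p i + p j) * (wave p ξ₀ 0 x t i * wave p ξ₀ 0 x t j
        - ε * conj (C i) * C j.rev - ε * C i.rev * conj (C j)) := by
  simp [symMat, mat, hp, conj_phase hp hξ, wave, Complex.exp_add]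

theorem add_ne_zero_of_add_conj {p : Fin N → ℂ} (hp : ∀ i, conj (p i) = p i.rev)
    (hden : ∀ i j, p i + conj (p j) ≠ 0) (i j : Fin N) : p i + p j ≠ 0 := by
  simpa [hp] using hden i j.rev

theorem transpose_symMat {ε : ℝ} {p ξ₀ C : Fin N → ℂ} (hp : ∀ i, conj (p i) = p i.rev)
    (hξ : ∀ i, conj (ξ₀ i) = ξ₀ i.rev) (x t : ℝ) :
    (symMat ε p ξ₀ C x t)ᵀ = symMat ε p ξ₀ C x t := by
  ext i j
  rw [transpose_apply, symMat_apply hp hξ, symMat_apply hp hξ, add_comm (p j)]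
  ring

theorem transpose_inv_symMat {ε : ℝ} {p ξ₀ C : Fin N → ℂ} (hp : ∀ i, conj (p i) = p i.rev)
    (hξ : ∀ i, conj (ξ₀ i) = ξ₀ i.rev) (x t : ℝ) :
    (symMat ε p ξ₀ C x t)⁻¹ᵀ = (symMat ε p ξ₀ C x t)⁻¹ := by
  rw [transpose_nonsing_inv, transpose_symMat hp hξ]

theorem det_symMat_ne_zero {ε : ℝ} {p ξ₀ C : Fin N → ℂ} {x t : ℝ}
    (hf : tauF ε p ξ₀ C x t ≠ 0) : (symMat ε p ξ₀ C x t).det ≠ 0 := by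
  rw [symMat, det_permute']
  refine mul_ne_zero ?_ hf
  rcases Int.units_eq_one_or (Equiv.Perm.sign (Fin.revPerm (n := N))) with h | h <;> simp [h]

theorem hasDerivAt_symMat_fst {ε : ℝ} {p ξ₀ C : Fin N → ℂ} (hp : ∀ i, conj (p i) = p i.rev)
    (hξ : ∀ i, conj (ξ₀ i) = ξ₀ i.rev) (hden : ∀ i j, p i + conj (p j) ≠ 0) (x t : ℝ)
    (i j : Fin N) :
    HasDerivAt (fun y => symMat ε p ξ₀ C y t i j)
      (vecMulVec (wave p ξ₀ 0 x t) (wave p ξ₀ 0 x t) i j) x := by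
  have hij := add_ne_zero_of_add_conj hp hden i j
  simp only [symMat_apply hp hξ]
  refine (((((hasDerivAt_wave_fst p ξ₀ 0 x t i).fun_mul (hasDerivAt_wave_fst p ξ₀ 0 x t j)).sub_const
    (ε * conj (C i) * C j.rev)).sub_const (ε * C i.rev * conj (C j))).const_mul
    (1 / (p i + p j))).congr_deriv ?_
  simp only [wave, vecMulVec_apply]
  field_simp
  ring

/-- The denominator divides the time exponent: (a³ + b³)/(a + b) = a² - ab + b². -/
theorem hasDerivAt_symMat_snd {ε : ℝ} {p ξ₀ C : Fin N → ℂ} (hp : ∀ i, conj (p i) = p i.rev)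
    (hξ : ∀ i, conj (ξ₀ i) = ξ₀ i.rev) (hden : ∀ i j, p i + conj (p j) ≠ 0) (x t : ℝ)
    (i j : Fin N) :
    HasDerivAt (fun s => symMat ε p ξ₀ C x s i j)
      ((vecMulVec (wave p ξ₀ 2 x t) (wave p ξ₀ 0 x t)
        - vecMulVec (wave p ξ₀ 1 x t) (wave p ξ₀ 1 x t)
        + vecMulVec (wave p ξ₀ 0 x t) (wave p ξ₀ 2 x t)) i j) t := by
  have hij := add_ne_zero_of_add_conj hp hden i j
  simp only [symMat_apply hp hξ]
  refine (((((hasDerivAt_wave_snd p ξ₀ 0 x t i).fun_mul (hasDerivAt_wave_snd p ξ₀ 0 x t j)).sub_const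
    (ε * conj (C i) * C j.rev)).sub_const (ε * C i.rev * conj (C j))).const_mul
    (1 / (p i + p j))).congr_deriv ?_
  simp only [wave, vecMulVec_apply, Matrix.add_apply, Matrix.sub_apply]
  field_simp
  ring

theorem diagonal_mulVec_wave (p ξ₀ : Fin N → ℂ) (k : ℕ) (x t : ℝ) :
    diagonal p *ᵥ wave p ξ₀ k x t = wave p ξ₀ (k + 1) x t := by
  ext i
  simp only [mulVec_diagonal, wave]
  ring

/-- The Sylvester equation satisfied by the symmetric Gram matrix. -/
theorem sylvester_symMat {ε : ℝ} {p ξ₀ C : Fin N → ℂ} (hp : ∀ i, conj (p i) = p i.rev)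
    (hξ : ∀ i, conj (ξ₀ i) = ξ₀ i.rev) (hden : ∀ i j, p i + conj (p j) ≠ 0) (x t : ℝ) :
    diagonal p * symMat ε p ξ₀ C x t + symMat ε p ξ₀ C x t * diagonal p =
      vecMulVec (wave p ξ₀ 0 x t) (wave p ξ₀ 0 x t)
        - (ε : ℂ) • (vecMulVec (star C) (C ∘ Fin.rev) + vecMulVec (C ∘ Fin.rev) (star C)) := by
  ext i j
  have hij := add_ne_zero_of_add_conj hp hden i j
  simp only [Matrix.add_apply, diagonal_mul, mul_diagonal, symMat_apply hp hξ, Matrix.sub_apply,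
    Matrix.smul_apply, vecMulVec_apply, Pi.star_apply, Function.comp_apply, smul_eq_mul,
    starRingEnd_apply]
  field_simp
  ring

/-! ### Closed differential system for the pairings -/

section Flow

variable {ε : ℝ} {p ξ₀ C : Fin N → ℂ} {x t : ℝ}

theorem potential_comm (hp : ∀ i, conj (p i) = p i.rev) (hξ : ∀ i, conj (ξ₀ i) = ξ₀ i.rev)
    (j k : ℕ) : potential ε p ξ₀ C j k x t = potential ε p ξ₀ C k j x t :=
  dotProduct_mulVec_comm_of_transpose_eq (transpose_inv_symMat hp hξ x t) _ _

theorem wave_dotProduct_inv_mulVec (hp : ∀ i, conj (p i) = p i.rev)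
    (hξ : ∀ i, conj (ξ₀ i) = ξ₀ i.rev) (c : Fin N → ℂ) (k : ℕ) :
    wave p ξ₀ k x t ⬝ᵥ (symMat ε p ξ₀ C x t)⁻¹ *ᵥ c = pairing ε p ξ₀ C c k x t :=
  dotProduct_mulVec_comm_of_transpose_eq (transpose_inv_symMat hp hξ x t) _ _

/-- Multiply the Sylvester equation by K⁻¹ on both sides and pair with Aʲφ and Aᵏφ; the left side
becomes K⁻¹A + AK⁻¹. -/
theorem potential_succ_add (hp : ∀ i, conj (p i) = p i.rev) (hξ : ∀ i, conj (ξ₀ i) = ξ₀ i.rev)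
    (hden : ∀ i j, p i + conj (p j) ≠ 0) (hf : tauF ε p ξ₀ C x t ≠ 0) (j k : ℕ) :
    potential ε p ξ₀ C (j + 1) k x t + potential ε p ξ₀ C j (k + 1) x t =
      potential ε p ξ₀ C j 0 x t * potential ε p ξ₀ C 0 k x t
        - ε * (pairing ε p ξ₀ C (star C) j x t * pairing ε p ξ₀ C (C ∘ Fin.rev) k x t
          + pairing ε p ξ₀ C (C ∘ Fin.rev) j x t * pairing ε p ξ₀ C (star C) k x t) := by
  have hdet : IsUnit (symMat ε p ξ₀ C x t).det := (det_symMat_ne_zero hf).isUnit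
  have hG : (symMat ε p ξ₀ C x t)⁻¹ * (diagonal p * symMat ε p ξ₀ C x t
      + symMat ε p ξ₀ C x t * diagonal p) * (symMat ε p ξ₀ C x t)⁻¹
      = (symMat ε p ξ₀ C x t)⁻¹ * diagonal p + diagonal p * (symMat ε p ξ₀ C x t)⁻¹ := by
    rw [mul_add, add_mul, ← mul_assoc, mul_nonsing_inv_cancel_right _ _ hdet, ← mul_assoc,
      nonsing_inv_mul _ hdet, one_mul]
  rw [sylvester_symMat hp hξ hden] at hG
  have h := congrArg (fun B => wave p ξ₀ j x t ⬝ᵥ B *ᵥ wave p ξ₀ k x t) hG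
  simp only [mul_sub, sub_mul, Matrix.mul_smul, Matrix.smul_mul, mul_add, add_mul, sub_mulVec,
    add_mulVec, smul_mulVec, dotProduct_sub, dotProduct_add, dotProduct_smul, smul_eq_mul,
    dotProduct_mul_vecMulVec_mul_mulVec, wave_dotProduct_inv_mulVec hp hξ (star C),
    wave_dotProduct_inv_mulVec hp hξ (C ∘ Fin.rev)] at h
  rw [← mulVec_mulVec, ← mulVec_mulVec, diagonal_mulVec_wave,
    dotProduct_mulVec _ (diagonal p), ← mulVec_transpose, diagonal_transpose,
    diagonal_mulVec_wave, ← mul_add] at h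
  exact (add_comm _ _).trans h.symm

theorem hasDerivAt_pairing_fst (hp : ∀ i, conj (p i) = p i.rev)
    (hξ : ∀ i, conj (ξ₀ i) = ξ₀ i.rev) (hden : ∀ i j, p i + conj (p j) ≠ 0)
    (hf : tauF ε p ξ₀ C x t ≠ 0) (c : Fin N → ℂ) (k : ℕ) :
    HasDerivAt (fun y => pairing ε p ξ₀ C c k y t)
      (pairing ε p ξ₀ C c (k + 1) x t
        - pairing ε p ξ₀ C c 0 x t * potential ε p ξ₀ C 0 k x t) x := by
  refine (hasDerivAt_dotProduct_inv_mulVec (hasDerivAt_symMat_fst hp hξ hden x t)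
    (det_symMat_ne_zero hf) (fun i => hasDerivAt_const x (c i))
    (hasDerivAt_wave_fst p ξ₀ k x t)).congr_deriv ?_
  rw [dotProduct_mul_vecMulVec_mul_mulVec]
  change (0 : Fin N → ℂ) ⬝ᵥ _ + _ - _ = _
  rw [zero_dotProduct, zero_add]
  rfl

theorem hasDerivAt_pairing_snd (hp : ∀ i, conj (p i) = p i.rev)
    (hξ : ∀ i, conj (ξ₀ i) = ξ₀ i.rev) (hden : ∀ i j, p i + conj (p j) ≠ 0)
    (hf : tauF ε p ξ₀ C x t ≠ 0) (c : Fin N → ℂ) (k : ℕ) :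
    HasDerivAt (fun s => pairing ε p ξ₀ C c k x s)
      (pairing ε p ξ₀ C c (k + 3) x t
        - (pairing ε p ξ₀ C c 2 x t * potential ε p ξ₀ C 0 k x t
          - pairing ε p ξ₀ C c 1 x t * potential ε p ξ₀ C 1 k x t
          + pairing ε p ξ₀ C c 0 x t * potential ε p ξ₀ C 2 k x t)) t := by
  refine (hasDerivAt_dotProduct_inv_mulVec (hasDerivAt_symMat_snd hp hξ hden x t)
    (det_symMat_ne_zero hf) (fun i => hasDerivAt_const t (c i))
    (hasDerivAt_wave_snd p ξ₀ k x t)).congr_deriv ?_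
  simp only [mul_sub, sub_mul, mul_add, add_mul, sub_mulVec, add_mulVec, dotProduct_sub,
    dotProduct_add, dotProduct_mul_vecMulVec_mul_mulVec]
  change (0 : Fin N → ℂ) ⬝ᵥ _ + _ - _ = _
  rw [zero_dotProduct, zero_add]
  rfl

/-- Direct differentiation gives S_{j+1,k} + S_{j,k+1} - S_j0 S_0k; the Sylvester relation removes
the raised indices. -/
theorem hasDerivAt_potential_fst (hp : ∀ i, conj (p i) = p i.rev)
    (hξ : ∀ i, conj (ξ₀ i) = ξ₀ i.rev) (hden : ∀ i j, p i + conj (p j) ≠ 0)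
    (hf : tauF ε p ξ₀ C x t ≠ 0) (j k : ℕ) :
    HasDerivAt (fun y => potential ε p ξ₀ C j k y t)
      (-ε * (pairing ε p ξ₀ C (star C) j x t * pairing ε p ξ₀ C (C ∘ Fin.rev) k x t
          + pairing ε p ξ₀ C (C ∘ Fin.rev) j x t * pairing ε p ξ₀ C (star C) k x t)) x := by
  refine (hasDerivAt_dotProduct_inv_mulVec (hasDerivAt_symMat_fst hp hξ hden x t)
    (det_symMat_ne_zero hf) (hasDerivAt_wave_fst p ξ₀ j x t)
    (hasDerivAt_wave_fst p ξ₀ k x t)).congr_deriv ?_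
  rw [dotProduct_mul_vecMulVec_mul_mulVec]
  exact (sub_eq_of_eq_add' (potential_succ_add hp hξ hden hf j k)).trans (neg_mul _ _).symm

end Flow

/-! ### u and its conjugate as pairings -/

section Soliton

variable {ε : ℝ} {p ξ₀ C : Fin N → ℂ} {x t : ℝ}

theorem inv_mat_apply (i j : Fin N) :
    (mat ε p ξ₀ C x t)⁻¹ i j = (symMat ε p ξ₀ C x t)⁻¹ i.rev j := by
  have h := inv_submatrix_equiv (mat ε p ξ₀ C x t) (Equiv.refl (Fin N)) Fin.revPerm
  change (symMat ε p ξ₀ C x t)⁻¹ = _ at h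
  simp [h]

theorem brightSoliton_eq_dotProduct (hf : tauF ε p ξ₀ C x t ≠ 0) :
    brightSoliton ε p ξ₀ C x t = C ⬝ᵥ (mat ε p ξ₀ C x t)⁻¹ *ᵥ wave p ξ₀ 0 x t := by
  have hu : IsUnit (mat ε p ξ₀ C x t) := (isUnit_iff_isUnit_det _).2 (IsUnit.mk0 _ hf)
  let _ := hu.invertible
  -- Schur complement of M: the bordered determinant is f · CᵀM⁻¹φ.
  rw [brightSoliton, div_eq_iff hf, tauG, det_fromBlocks₁₁, invOf_eq_nonsing_inv, mul_comm]
  congr 1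
  simp only [det_unique, Matrix.neg_mul, zero_sub, neg_neg]
  rw [Matrix.mul_assoc, Matrix.mul_apply, dotProduct]
  refine Finset.sum_congr rfl fun i _ => ?_
  simp [Matrix.mul_apply, mulVec, dotProduct, wave]

theorem brightSoliton_eq_pairing (hf : tauF ε p ξ₀ C x t ≠ 0) :
    brightSoliton ε p ξ₀ C x t = pairing ε p ξ₀ C (C ∘ Fin.rev) 0 x t := by
  rw [brightSoliton_eq_dotProduct hf, pairing]
  simp only [dotProduct, mulVec, inv_mat_apply]
  rw [← Equiv.sum_comp Fin.revPerm]
  simp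

theorem conjTranspose_mat : (mat ε p ξ₀ C x t)ᴴ = mat ε p ξ₀ C x t := by
  ext i j
  simp only [conjTranspose_apply, mat, of_apply, ← starRingEnd_apply, map_mul, map_sub, map_div₀,
    map_one, map_add, Complex.conj_conj, ← Complex.exp_conj, Complex.conj_ofReal]
  rw [add_comm (conj (p j)), add_comm (conj (phase p ξ₀ x t j))]
  ring

/-- M is Hermitian, so conjugation gives φ^*ᵀM⁻¹C^*. Since φ^* is φ reversed, reindexing absorbs the
reversal into K⁻¹, whose symmetry then swaps the two vectors. -/
theorem conj_brightSoliton_eq_pairing (hp : ∀ i, conj (p i) = p i.rev)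
    (hξ : ∀ i, conj (ξ₀ i) = ξ₀ i.rev) (hf : tauF ε p ξ₀ C x t ≠ 0) :
    conj (brightSoliton ε p ξ₀ C x t) = pairing ε p ξ₀ C (star C) 0 x t := by
  rw [brightSoliton_eq_dotProduct hf, starRingEnd_apply, ← star_dotProduct_star,
    star_mulVec, conjTranspose_nonsing_inv, conjTranspose_mat, ← dotProduct_mulVec,
    ← wave_dotProduct_inv_mulVec hp hξ]
  simp only [dotProduct, mulVec, inv_mat_apply]
  rw [← Equiv.sum_comp Fin.revPerm]
  simp [← starRingEnd_apply, conj_wave_zero hp hξ]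

end Soliton

/-! ### Smoothness of f and g -/

section Smooth

variable (ε : ℝ) (p ξ₀ C : Fin N → ℂ)

theorem contDiff_det {n : Type*} [Fintype n] [DecidableEq n] {E : Type*} [NormedAddCommGroup E]
    [NormedSpace ℝ E] {B : E → Matrix n n ℂ} (hB : ∀ i j, ContDiff ℝ ∞ fun z => B z i j) :
    ContDiff ℝ ∞ fun z => (B z).det := by
  simp only [det_apply']
  exact ContDiff.sum fun σ _ => contDiff_const.mul (contDiff_prod fun i _ => hB _ _)

theorem contDiff_phase (i : Fin N) :
    ContDiff ℝ ∞ fun z : ℝ × ℝ => phase p ξ₀ z.1 z.2 i := by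
  unfold phase
  exact ((contDiff_const.mul (Complex.ofRealCLM.contDiff.comp contDiff_fst)).add
    (contDiff_const.mul (Complex.ofRealCLM.contDiff.comp contDiff_snd))).add contDiff_const

theorem contDiff_mat (i j : Fin N) :
    ContDiff ℝ ∞ fun z : ℝ × ℝ => mat ε p ξ₀ C z.1 z.2 i j := by
  simp only [mat, of_apply]
  exact contDiff_const.mul (((((contDiff_phase p ξ₀ i).add
    (Complex.conjCLE.contDiff.comp (contDiff_phase p ξ₀ j))).cexp).sub contDiff_const).sub
    contDiff_const)

theorem contDiff_tauF : ContDiff ℝ ∞ fun z : ℝ × ℝ => tauF ε p ξ₀ C z.1 z.2 :=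
  contDiff_det (contDiff_mat ε p ξ₀ C)

theorem contDiff_tauG : ContDiff ℝ ∞ fun z : ℝ × ℝ => tauG ε p ξ₀ C z.1 z.2 := by
  refine contDiff_det fun i j => ?_
  rcases i with i | i <;> rcases j with j | j
  · exact contDiff_mat ε p ξ₀ C i j
  · exact (contDiff_phase p ξ₀ i).cexp
  · exact contDiff_const
  · exact contDiff_const

end Smooth

end SasaSatsuma

open SasaSatsuma Filter Topology in
theorem theorem5p1 (N : ℕ) (ε : ℝ) (p ξ₀ C : Fin N → ℂ)
    (hp : ∀ i, conj (p i) = p i.rev)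
    (hξ : ∀ i, conj (ξ₀ i) = ξ₀ i.rev)
    (hden : ∀ i j, p i + conj (p j) ≠ 0) :
    SasaSatsuma.IsSolutionOn ε (SasaSatsuma.brightSoliton ε p ξ₀ C)
      {z : ℝ × ℝ | SasaSatsuma.tauF ε p ξ₀ C z.1 z.2 ≠ 0} := by
  refine ⟨isOpen_ne_fun (contDiff_tauF ε p ξ₀ C).continuous continuous_const,
    by
      simp only [brightSoliton, div_eq_mul_inv]
      exact (contDiff_tauG ε p ξ₀ C).contDiffOn.mul
        ((contDiff_tauF ε p ξ₀ C).contDiffOn.inv fun _ hz => hz),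
    fun x t hf => ?_⟩
  change tauF ε p ξ₀ C x t ≠ 0 at hf
  set U : ℕ → ℝ → ℂ := fun k y => pairing ε p ξ₀ C (C ∘ Fin.rev) k y t
  set V : ℕ → ℝ → ℂ := fun k y => pairing ε p ξ₀ C (star C) k y t
  set S : ℕ → ℕ → ℝ → ℂ := fun j k y => potential ε p ξ₀ C j k y t
  have hcont : Continuous fun z : ℝ × ℝ => tauF ε p ξ₀ C z.1 z.2 :=
    (contDiff_tauF ε p ξ₀ C).continuous
  have hx : ∀ᶠ y in 𝓝 x, tauF ε p ξ₀ C y t ≠ 0 :=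
    (hcont.comp (Continuous.prodMk_left t)).continuousAt.eventually_ne hf
  have ht : ∀ᶠ s in 𝓝 t, tauF ε p ξ₀ C x s ≠ 0 :=
    (hcont.comp (Continuous.prodMk_right x)).continuousAt.eventually_ne hf
  have dU : ∀ k y, tauF ε p ξ₀ C y t ≠ 0 →
      HasDerivAt (U k) (U (k + 1) y - U 0 y * S 0 k y) y :=
    fun k y hy => hasDerivAt_pairing_fst hp hξ hden hy _ k
  have dV : ∀ k y, tauF ε p ξ₀ C y t ≠ 0 →
      HasDerivAt (V k) (V (k + 1) y - V 0 y * S 0 k y) y :=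
    fun k y hy => hasDerivAt_pairing_fst hp hξ hden hy _ k
  have dS : ∀ j k y, tauF ε p ξ₀ C y t ≠ 0 →
      HasDerivAt (S j k) (-ε * (V j y * U k y + U j y * V k y)) y :=
    fun j k y hy => hasDerivAt_potential_fst hp hξ hden hy j k
  have eU : (fun y => brightSoliton ε p ξ₀ C y t) =ᶠ[𝓝 x] U 0 :=
    hx.mono fun y hy => brightSoliton_eq_pairing hy
  have dU₂ : ∀ y, tauF ε p ξ₀ C y t ≠ 0 →
      HasDerivAt (fun y => U 1 y - U 0 y * S 0 0 y)
        ((U 2 y - U 0 y * S 0 1 y) - ((U 1 y - U 0 y * S 0 0 y) * S 0 0 y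
          + U 0 y * (-ε * (V 0 y * U 0 y + U 0 y * V 0 y)))) y :=
    fun y hy => (dU 1 y hy).fun_sub ((dU 0 y hy).fun_mul (dS 0 0 y hy))
  have dU₃ := ((dU 2 x hf).fun_sub ((dU 0 x hf).fun_mul (dS 0 1 x hf))).fun_sub
    (((dU₂ x hf).fun_mul (dS 0 0 x hf)).fun_add ((dU 0 x hf).fun_mul
      ((((dV 0 x hf).fun_mul (dU 0 x hf)).fun_add
        ((dU 0 x hf).fun_mul (dV 0 x hf))).const_mul (-(ε : ℂ)))))
  have e₁ : deriv (fun y => brightSoliton ε p ξ₀ C y t) =ᶠ[𝓝 x]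
      fun y => U 1 y - U 0 y * S 0 0 y :=
    eU.deriv.trans (hx.mono fun y hy => (dU 0 y hy).deriv)
  have e₂ := e₁.deriv.trans (hx.mono fun y hy => (dU₂ y hy).deriv)
  have e₃ := e₂.deriv_eq.trans dU₃.deriv
  have et : deriv (fun s => brightSoliton ε p ξ₀ C x s) t =
      U 3 x - (U 2 x * S 0 0 x - U 1 x * S 1 0 x + U 0 x * S 2 0 x) := by
    have eT : (fun s => brightSoliton ε p ξ₀ C x s) =ᶠ[𝓝 t]
        fun s => pairing ε p ξ₀ C (C ∘ Fin.rev) 0 x s :=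
      ht.mono fun s hs => brightSoliton_eq_pairing hs
    rw [eT.deriv_eq]
    exact (hasDerivAt_pairing_snd hp hξ hden hf _ 0).deriv
  have hnorm : ∀ y, tauF ε p ξ₀ C y t ≠ 0 →
      ((‖brightSoliton ε p ξ₀ C y t‖ ^ 2 : ℝ) : ℂ) = U 0 y * V 0 y := fun y hy => by
    have h := Complex.mul_conj' (brightSoliton ε p ξ₀ C y t)
    rw [conj_brightSoliton_eq_pairing hp hξ hy, brightSoliton_eq_pairing hy] at h
    rw [brightSoliton_eq_pairing hy, Complex.ofReal_pow]
    exact h.symm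
  have dnorm : ((deriv (fun y => ‖brightSoliton ε p ξ₀ C y t‖ ^ 2) x : ℝ) : ℂ) =
      (U 1 x - U 0 x * S 0 0 x) * V 0 x + U 0 x * (V 1 x - V 0 x * S 0 0 x) := by
    have hd : DifferentiableAt ℝ (fun y => brightSoliton ε p ξ₀ C y t) x :=
      ((dU 0 x hf).congr_of_eventuallyEq eU).differentiableAt
    -- The cast of |u|² is U₀V₀ near x, so the two derivatives agree by uniqueness.
    have h := (hd.norm_sq ℝ).hasDerivAt.ofReal_comp
    have h' := ((dU 0 x hf).fun_mul (dV 0 x hf)).congr_of_eventuallyEq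
      (hx.mono fun y hy => hnorm y hy)
    exact h.unique h'
  have s01 : S 1 0 x + S 0 1 x = S 0 0 x * S 0 0 x - ε * (V 0 x * U 0 x + U 0 x * V 0 x) :=
    potential_succ_add hp hξ hden hf 0 0
  have c01 : S 1 0 x = S 0 1 x := potential_comm hp hξ 1 0
  have c02 : S 2 0 x = S 0 2 x := potential_comm hp hξ 2 0
  have hi : iteratedDeriv 3 (fun y => brightSoliton ε p ξ₀ C y t) x =
      deriv (deriv (deriv fun y => brightSoliton ε p ξ₀ C y t)) x := by
    simp only [iteratedDeriv_succ, iteratedDeriv_zero]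
  rw [et, hi, e₃, hnorm x hf, e₁.eq_of_nhds, dnorm, eU.eq_of_nhds, c01, c02]
  rw [c01] at s01
  -- The coefficient is u_x.
  linear_combination (U 1 x - U 0 x * S 0 0 x) * s01
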